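/- All graphs are finite and simple. A subtree of an edge-coloured graph is *proper* if any two adjacent edges of it have different colours. A $3$-proper colouring of a connected graph $G$ is a colouring $E(G)\to\{1,\dots,t\}$ (adjacent edges may receive the same colour) such that every set of exactly three vertices of $G$ is contained in some proper tree of $G$; $px_3(G)$ is the smallest $t$ for which such a colouring exists. (If $G$ has fewer than three vertices the condition on triples is void, so $px_3(K_1)=0$ and $px_3(K_2)=1$.) A set $D\subseteq V(G)$ is a *connected $3$-way dominating set* of $G$ if every vertex outside $D$ has a neighbour in $D$, every vertex outside $D$ has degree at least $3$ in $G$, and the induced subgraph $G[D]$ is connected (in particular $D\neq\emptyset$). **Theorem.** If $D$ is a connected $3$-way dominating set of a connected graph $G$, then $px_3(G)\le px_3(G[D])+3$. Moreover, this bound is tight: let $p\ge 3$ and $i_1,\dots,i_p\ge 4$, and let $G$ be the graph formed by $p$ complete graphs $K_{i_1},\dots,K_{i_p}$ that have exactly one vertex $v_0$ in common. Then $G$ is connected, $\{v_0\}$ is a connected $3$-way dominating set of $G$, $px_3(G[\{v_0\}])=0$ and $px_3(G)=3$. -/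

import Mathlib

namespace ProperIndex

universe u v

/-- A subgraph `T` of an edge-coloured graph `G` is a proper tree: it is a tree, and any two
distinct edges of `T` which share an endpoint have different colours. -/
def IsProperTree {V : Type u} {G : SimpleGraph V} {K : Type v} (c : G.EdgeLabeling K)
    (T : G.Subgraph) : Prop :=
  T.coe.IsTree ∧
    ∀ (x y z : V) (hy : T.Adj x y) (hz : T.Adj x z), y ≠ z →
      c.get x y hy.adj_sub ≠ c.get x z hz.adj_sub

/-- `c` is a `k`-proper colouring: every set `S` of exactly `k` vertices is contained in the vertex
set of a proper tree of `G`. -/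
def IsKProperColoring {V : Type u} {G : SimpleGraph V} {K : Type v} (k : ℕ)
    (c : G.EdgeLabeling K) : Prop :=
  ∀ S : Finset V, S.card = k → ∃ T : G.Subgraph, (S : Set V) ⊆ T.verts ∧ IsProperTree c T

/-- The `k`-proper index `px_k(G)`: the least `t` such that `G` has a `k`-proper colouring
`E(G) → {1, …, t}`. For a finite connected graph such a `t` exists, see
`exists_isKProperColoring`, so this is a minimum. -/
noncomputable def properIndex {V : Type u} (k : ℕ) (G : SimpleGraph V) : ℕ :=
  sInf {t : ℕ | ∃ c : G.EdgeLabeling (Fin t), IsKProperColoring k c}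

/-- Every finite connected graph has a `k`-proper colouring with finitely many colours. -/
theorem exists_isKProperColoring {V : Type u} [Finite V] (k : ℕ) {G : SimpleGraph V}
    (hG : G.Connected) :
    {t : ℕ | ∃ c : G.EdgeLabeling (Fin t), IsKProperColoring k c}.Nonempty := by
  obtain ⟨F, hF, hT⟩ := hG.exists_isTree_le
  obtain ⟨t, ⟨e⟩⟩ := Finite.exists_equiv_fin G.edgeSet
  refine ⟨t, fun x => e x, fun S _ => ⟨SimpleGraph.toSubgraph F hF, by simp, ?_, ?_⟩⟩
  · have hs : (SimpleGraph.toSubgraph F hF).IsSpanning := SimpleGraph.toSubgraph.isSpanning F hF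
    exact ((SimpleGraph.Subgraph.spanningCoeEquivCoeOfSpanning _ hs).isTree_iff).1
      (show F.IsTree from hT)
  · intro x y z hy hz hne h
    have h' : s(x, y) = s(x, z) := congrArg Subtype.val (e.injective h)
    simp only [Sym2.eq_iff] at h'
    rcases h' with ⟨_, h'⟩ | ⟨h1, h2⟩
    · exact hne h'
    · exact hne (h2.trans h1)

/-- `D` is a dominating set: every vertex outside `D` has a neighbour in `D`. -/
def IsDominating {V : Type u} (G : SimpleGraph V) (D : Set V) : Prop :=
  ∀ x ∉ D, ∃ y ∈ D, G.Adj x y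

/-- `D` is a connected `s`-way dominating set: `D` is dominating, every vertex outside `D` has
degree at least `s` in `G`, and the induced subgraph `G[D]` is connected (hence nonempty). -/
structure IsConnectedWayDominating {V : Type u} (s : ℕ) (G : SimpleGraph V) (D : Set V) :
    Prop where
  dominating : IsDominating G D
  degree_ge : ∀ x ∉ D, (s : ℕ∞) ≤ (G.neighborSet x).encard
  connected : (G.induce D).Connected

/-- The vertices of `p` complete graphs `K_{i 0}, …, K_{i (p-1)}` glued at one vertex: the shared
vertex is `none`, and the `j`-th complete graph has `i j - 1` further vertices `some ⟨j, a⟩`. -/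
abbrev CliqueUnionVertex {p : ℕ} (i : Fin p → ℕ) : Type :=
  Option (Σ j : Fin p, Fin (i j - 1))

/-- The vertex set of the `j`-th complete graph. -/
def cliquePart {p : ℕ} (i : Fin p → ℕ) (j : Fin p) : Set (CliqueUnionVertex i) :=
  {x | x = none ∨ ∃ a : Fin (i j - 1), x = some ⟨j, a⟩}

/-- The graph obtained from `p` complete graphs `K_{i 0}, …, K_{i (p-1)}` with exactly one vertex
in common: two vertices are adjacent if they are distinct and lie in the same complete graph. -/
def cliqueUnion {p : ℕ} (i : Fin p → ℕ) : SimpleGraph (CliqueUnionVertex i) where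
  Adj x y := x ≠ y ∧ ∃ j : Fin p, x ∈ cliquePart i j ∧ y ∈ cliquePart i j
  symm := ⟨fun _ _ ⟨hne, j, hx, hy⟩ => ⟨hne.symm, j, hy, hx⟩⟩
  loopless := ⟨fun _ h => h.1 rfl⟩

end ProperIndex

/-!
Colour `G[D]` optimally and take `ZMod 3` as the three new colours. Give the vertices outside `D` a
colouring `f` in `ZMod 3`; an edge `x y` outside `D` gets the colour `-(f x + f y)`, and among the
edges from `x` to `D`, the legs of `x`, one has the colour `f x`. A path from `x` to `D` whose
vertices outside `D` are at most three and have different colours, and whose last edge has the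
colour of the last of them, is then proper.

Choose `f` with as many bichromatic edges as possible and then as many vertices seeing all the other
colours as possible. Since every `x` outside `D` has degree at least three, recolouring a single
vertex shows that its legs can be coloured so that it sees every colour at distance one, or that it
starts a path with three different colours, with an alternative for the second vertex. Hence any
three vertices outside `D` enter `D` with three different colours along disjoint paths, unless one
of them already lies on the path of another. These paths are attached to a proper tree in `G[D]`
through the at most three ends of the paths.

The bound is attained by the union of at least three cliques with a common vertex: a tree through
vertices of three of the cliques has three edges at the common vertex.
-/

open SimpleGraph

namespace ProperIndex

section ProperTrees

variable {V K : Type*} {G : SimpleGraph V} {c : G.EdgeLabeling K} {T T' : G.Subgraph} {u w z : V}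

theorem isTree_coe_iff [Finite V] :
    T.coe.IsTree ↔ T.Connected ∧ T.edgeSet.ncard + 1 = T.verts.ncard := by
  have hcard : Nat.card T.coe.edgeSet = T.edgeSet.ncard := by
    rw [← Subgraph.image_coe_edgeSet_coe, Set.ncard_image_of_injective _
      (Sym2.map.injective Subtype.val_injective), Nat.card_coe_set_eq]
  rw [isTree_iff_connected_and_card, hcard, Subgraph.connected_iff', Nat.card_coe_set_eq]

theorem verts_sup_subgraphOfAdj (hu : u ∈ T.verts) (h : G.Adj u w) :
    (T ⊔ G.subgraphOfAdj h).verts = insert w T.verts := by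
  rw [Subgraph.verts_sup, subgraphOfAdj_verts]
  grind

theorem isTree_coe_sup_subgraphOfAdj [Finite V] (hT : T.coe.IsTree) (hu : u ∈ T.verts)
    (hw : w ∉ T.verts) (h : G.Adj u w) : (T ⊔ G.subgraphOfAdj h).coe.IsTree := by
  rw [isTree_coe_iff] at hT ⊢
  have hedges : (T ⊔ G.subgraphOfAdj h).edgeSet = insert s(u, w) T.edgeSet := by
    rw [Subgraph.edgeSet_sup, edgeSet_subgraphOfAdj, Set.union_comm, Set.singleton_union]
  have hnew : s(u, w) ∉ T.edgeSet := fun huw => hw (T.edge_vert huw.symm)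
  refine ⟨Subgraph.connected_sup hT.1.preconnected
    (Subgraph.subgraphOfAdj_connected h).preconnected ⟨u, hu, by simp⟩, ?_⟩
  rw [hedges, verts_sup_subgraphOfAdj hu, Set.ncard_insert_of_notMem hnew (Set.toFinite _),
    Set.ncard_insert_of_notMem hw (Set.toFinite _), hT.2]

/-- The set of colours which the edges of the subgraph `T` have at the vertex `z`. -/
def colorsAt (c : G.EdgeLabeling K) (T : G.Subgraph) (z : V) : Set K :=
  {k | ∃ (w : V) (h : T.Adj z w), c.get z w h.adj_sub = k}

theorem colorsAt_eq_empty (hz : z ∉ T.verts) : colorsAt c T z = ∅ :=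
  Set.eq_empty_of_forall_notMem fun _ ⟨_, h, _⟩ => hz (T.edge_vert h)

theorem colorsAt_sup : colorsAt c (T ⊔ T') z = colorsAt c T z ∪ colorsAt c T' z := by
  ext k
  simp only [colorsAt, Set.mem_union, Set.mem_ofPred_eq, Subgraph.sup_adj]
  grind

theorem colorsAt_subgraphOfAdj_left (h : G.Adj u w) :
    colorsAt c (G.subgraphOfAdj h) u = {c.get u w h} := by
  ext k
  simp only [colorsAt, Set.mem_ofPred_eq, Set.mem_singleton_iff, subgraphOfAdj_adj]
  grind [h.ne]

theorem colorsAt_subgraphOfAdj_right (h : G.Adj u w) :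
    colorsAt c (G.subgraphOfAdj h) w = {c.get u w h} := by
  rw [← subgraphOfAdj_symm h, colorsAt_subgraphOfAdj_left, EdgeLabeling.get_comm]

theorem IsProperTree.sup_subgraphOfAdj [Finite V] (hT : IsProperTree c T) (hu : u ∈ T.verts)
    (hw : w ∉ T.verts) (h : G.Adj u w) (hc : c.get u w h ∉ colorsAt c T u) :
    IsProperTree c (T ⊔ G.subgraphOfAdj h) := by
  refine ⟨isTree_coe_sup_subgraphOfAdj hT.1 hu hw h, ?_⟩
  have hne : ∀ x y z (hy : T.Adj x y) (hz : (G.subgraphOfAdj h).Adj x z),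
      c.get x y hy.adj_sub ≠ c.get x z hz.adj_sub := by
    intro x y z hy hz
    rw [subgraphOfAdj_adj, Sym2.eq_iff] at hz
    obtain ⟨rfl, rfl⟩ | ⟨rfl, rfl⟩ := hz
    · exact fun heq => hc ⟨y, hy, heq⟩
    · exact absurd (T.edge_vert hy) hw
  rintro x y z (hy | hy) (hz | hz) hyz
  · exact hT.2 x y z hy hz hyz
  · exact hne x y z hy hz
  · exact (hne x z y hz hy).symm
  · rw [subgraphOfAdj_adj, Sym2.eq_iff] at hy hz
    grind [h.ne]

theorem IsProperTree.exists_attach_leaf [Finite V] (hT : IsProperTree c T) (hu : u ∈ T.verts)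
    (hw : w ∉ T.verts) (h : G.Adj w u) (hc : c.get w u h ∉ colorsAt c T u) :
    ∃ T' : G.Subgraph, IsProperTree c T' ∧ T'.verts = insert w T.verts ∧
      colorsAt c T' w = {c.get w u h} ∧ colorsAt c T' u = insert (c.get w u h) (colorsAt c T u) ∧
      ∀ z, z ≠ w → z ≠ u → colorsAt c T' z = colorsAt c T z := by
  have hget : c.get w u h = c.get u w h.symm := EdgeLabeling.get_comm ..
  refine ⟨T ⊔ G.subgraphOfAdj h.symm, hT.sup_subgraphOfAdj hu hw h.symm (hget ▸ hc),
    verts_sup_subgraphOfAdj hu h.symm, ?_, ?_, fun z hzw hzu => ?_⟩ <;> rw [colorsAt_sup]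
  · rw [colorsAt_eq_empty hw, colorsAt_subgraphOfAdj_right, hget, Set.empty_union]
  · rw [colorsAt_subgraphOfAdj_left, hget, Set.union_singleton]
  · have hz : z ∉ (G.subgraphOfAdj h.symm).verts := by simp [hzw, hzu]
    rw [colorsAt_eq_empty hz, Set.union_empty]

theorem exists_isTree_verts_eq_univ (hG : G.Connected) :
    ∃ T : G.Subgraph, T.verts = Set.univ ∧ T.coe.IsTree := by
  obtain ⟨F, hF, hT⟩ := hG.exists_isTree_le
  have hspan := toSubgraph.isSpanning F hF
  exact ⟨toSubgraph F hF, hspan.verts_eq_univ,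
    (Subgraph.spanningCoeEquivCoeOfSpanning _ hspan).isTree_iff.1 hT⟩

theorem exists_properTree_of_card_le [Finite V] (hG : G.Connected) {k : ℕ} (hk : k ≤ 3)
    (hc : IsKProperColoring k c) (S : Finset V) (hS : S.card ≤ k) :
    ∃ T : G.Subgraph, (S : Set V) ⊆ T.verts ∧ IsProperTree c T := by
  classical
  have := Fintype.ofFinite V
  by_cases hV : k ≤ Fintype.card V
  · obtain ⟨S', hS', hcard⟩ := Finset.exists_superset_card_eq hS hV
    obtain ⟨T, hT, hT'⟩ := hc S' hcard
    exact ⟨T, (Finset.coe_subset.2 hS').trans hT, hT'⟩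
  · -- with at most two vertices there are no adjacent edges, so any spanning tree is proper
    obtain ⟨T, hverts, hT⟩ := exists_isTree_verts_eq_univ hG
    refine ⟨T, hverts ▸ Set.subset_univ _, hT, fun x y z hy hz hyz => ?_⟩
    have hthree : ({x, y, z} : Finset V).card = 3 :=
      Finset.card_eq_three.2 ⟨x, y, z, hy.adj_sub.ne, hz.adj_sub.ne, hyz, rfl⟩
    have := Finset.card_le_univ ({x, y, z} : Finset V)
    omega

theorem properIndex_le_card [Fintype K] {k : ℕ} (hc : IsKProperColoring k c) :
    properIndex k G ≤ Fintype.card K := by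
  refine Nat.sInf_le ⟨c.compRight (Fintype.equivFin K), fun S hS => ?_⟩
  obtain ⟨T, hST, hT, hp⟩ := hc S hS
  exact ⟨T, hST, hT, fun x y z hy hz hyz h =>
    hp x y z hy hz hyz ((Fintype.equivFin K).injective h)⟩

theorem IsProperTree.map {W K₀ : Type*} {H : SimpleGraph W} {c₀ : H.EdgeLabeling K₀}
    {T₀ : H.Subgraph} (hT : IsProperTree c₀ T₀) (f : Copy H G) {φ : K₀ → K}
    (hφ : Function.Injective φ)
    (hc : ∀ (x y : W) (h : H.Adj x y), c.get (f x) (f y) (f.toHom.map_adj h) = φ (c₀.get x y h)) :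
    IsProperTree c (T₀.map f.toHom) := by
  refine ⟨(f.isoSubgraphMap T₀).isTree_iff.1 hT.1, ?_⟩
  rintro _ _ _ ⟨x, y, hy, rfl, rfl⟩ ⟨x', z, hz, hx, rfl⟩ hyz heq
  obtain rfl : x' = x := f.injective hx
  refine hT.2 x' y z hy hz (fun h => hyz (by rw [h])) (hφ ?_)
  rw [← hc, ← hc]
  exact heq

end ProperTrees

section OptimalColorings

variable {V C : Type*} {H : SimpleGraph V} {f : V → C} {x y z : V}

/-- The spanning subgraph of `H` of the edges whose ends get different colours from `f`. -/
def bichromatic (H : SimpleGraph V) (f : V → C) : SimpleGraph V :=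
  H ⊓ (⊤ : SimpleGraph C).comap f

theorem bichromatic_adj : (bichromatic H f).Adj x y ↔ H.Adj x y ∧ f x ≠ f y := Iff.rfl

/-- A vertex is colourful for the vertex colouring `f` if it sees every colour but its own among
its neighbours. -/
def IsColorful (H : SimpleGraph V) (f : V → C) (x : V) : Prop :=
  ∀ t ≠ f x, ∃ y, H.Adj x y ∧ f y = t

/-- A vertex colouring is optimal if its set of bichromatic edges is maximal and, among the
colourings with the same bichromatic edges, its set of colourful vertices is maximal. -/
def IsOptimal (H : SimpleGraph V) (f : V → C) : Prop :=
  MaximalFor (fun _ => True)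
    (fun f : V → C => toLex (bichromatic H f, {x | IsColorful H f x})) f

/-- The vertex `x` starts a path `x, u, w` on which `f` takes three different colours, and has a
second neighbour of the colour of `u`. -/
def HasFork (H : SimpleGraph V) (f : V → C) (x : V) : Prop :=
  ∃ u u' w, H.Adj x u ∧ H.Adj x u' ∧ u ≠ u' ∧ f u' = f u ∧ f u ≠ f x ∧
    H.Adj u w ∧ f w ≠ f x ∧ f w ≠ f u

theorem exists_isOptimal (H : SimpleGraph V) [Finite V] [Finite C] [Nonempty C] :
    ∃ f : V → C, IsOptimal H f := by
  obtain ⟨f, hf⟩ := Set.Finite.exists_maximalFor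
    (fun f : V → C => toLex (bichromatic H f, {x | IsColorful H f x})) Set.univ
    Set.finite_univ Set.univ_nonempty
  exact ⟨f, hf⟩

open Classical in
theorem IsOptimal.isColorful_of_adj_of_eq (hf : IsOptimal H f) (hxy : H.Adj x y)
    (heq : f y = f x) : IsColorful H f x := by
  by_contra hx
  simp only [IsColorful, not_forall, not_exists, not_and] at hx
  obtain ⟨t, ht, hmiss⟩ := hx
  set f' := Function.update f x t
  have hself : f' x = t := Function.update_self ..
  have hother : ∀ z ≠ x, f' z = f z := fun z hz => Function.update_of_ne hz ..
  have hlt : bichromatic H f < bichromatic H f' := by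
    refine lt_of_le_of_ne (fun a b hab => ?_) fun h => ?_
    · rw [bichromatic_adj] at hab ⊢
      grind [H.adj_comm, hab.1.ne]
    · have : (bichromatic H f').Adj x y := by
        rw [bichromatic_adj, hself, hother y hxy.ne', heq]
        exact ⟨hxy, ht⟩
      rw [← h, bichromatic_adj] at this
      exact this.2 heq.symm
  exact hf.not_gt trivial (Prod.Lex.toLex_lt_toLex.2 (.inl hlt))

open Classical in
/-- Otherwise recolouring `v` would keep the bichromatic edges and the colourful vertices and make
`u` colourful. -/
theorem IsOptimal.not_isColorful_update (hf : IsOptimal H f) {u v : V} {t : C} (ht : t ≠ f v)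
    (hmiss : ∀ z, H.Adj v z → f z ≠ t) (hnbr : ∀ z, H.Adj v z → ¬ IsColorful H f z)
    (huv : H.Adj v u) : ¬ IsColorful H (Function.update f v t) u := by
  intro hu
  have hv : ¬ IsColorful H f v := fun h => by
    obtain ⟨z, hz, hzt⟩ := h t ht
    exact hmiss z hz hzt
  set f' := Function.update f v t
  have hself : f' v = t := Function.update_self ..
  have hother : ∀ z ≠ v, f' z = f z := fun z hz => Function.update_of_ne hz ..
  have hbi : bichromatic H f = bichromatic H f' := by
    have hown : ∀ z, H.Adj v z → f z ≠ f v := fun z hz h =>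
      hv (hf.isColorful_of_adj_of_eq hz h)
    ext a b
    rw [bichromatic_adj, bichromatic_adj]
    grind [H.adj_comm]
  have hlt : {z | IsColorful H f z} < {z | IsColorful H f' z} := by
    refine Set.ssubset_iff_of_subset (fun z hz => ?_) |>.2 ⟨u, hu, hnbr u huv⟩
    have hzv : z ≠ v := fun h => hv (h ▸ hz)
    intro s hs
    rw [hother z hzv] at hs
    obtain ⟨y, hzy, hys⟩ := hz s hs
    have hyv : y ≠ v := fun h => hnbr z (h ▸ hzy.symm) hz
    exact ⟨y, hzy, by rw [hother y hyv, hys]⟩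
  exact hf.not_gt trivial (Prod.Lex.toLex_lt_toLex.2 (.inr ⟨hbi, hlt⟩))

end OptimalColorings

section ThreeColors

theorem exists_ne_and_ne (a b : ZMod 3) : ∃ t, t ≠ a ∧ t ≠ b := by decide +revert

theorem eq_or_eq_or_eq_of_ne {a b c : ZMod 3} (hab : a ≠ b) (hac : a ≠ c) (hbc : b ≠ c)
    (t : ZMod 3) : t = a ∨ t = b ∨ t = c := by decide +revert

variable {V : Type*} {H : SimpleGraph V} {f : V → ZMod 3} {x y z : V}

theorem apply_ne_of_not_hasFork (hx : ¬ HasFork H f x) (hy : H.Adj x y) (hz : H.Adj x z)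
    (hyz : y ≠ z) {t : ZMod 3} (ht : t ≠ f x) (hnbr : ∀ u, H.Adj x u → f u ≠ f x ∧ f u ≠ t)
    {u w : V} (hu : H.Adj x u) (hw : H.Adj u w) : f w ≠ t := by
  rintro rfl
  obtain ⟨u', hu', hne⟩ : ∃ u', H.Adj x u' ∧ u ≠ u' := by
    by_cases h : u = y
    exacts [⟨z, hz, h ▸ hyz⟩, ⟨y, hy, h⟩]
  have hsame : f u' = f u :=
    ((eq_or_eq_or_eq_of_ne ht.symm (hnbr u hu).1.symm (hnbr u hu).2.symm (f u')).resolve_left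
      (hnbr u' hu').1).resolve_left (hnbr u' hu').2
  exact hx ⟨u, u', w, hu, hu', hne, hsame, (hnbr u hu).1, hw, ht, (hnbr u hu).2.symm⟩

theorem IsOptimal.isColorful_or_hasFork (hf : IsOptimal H f) (hy : H.Adj x y) (hz : H.Adj x z)
    (hyz : y ≠ z) : IsColorful H f x ∨ HasFork H f x := by
  classical
  by_contra! ⟨hx, hfork⟩
  obtain ⟨t, ht, hmiss⟩ : ∃ t ≠ f x, ∀ u, H.Adj x u → f u ≠ t := by
    simpa only [IsColorful, not_forall, not_exists, not_and, exists_prop] using hx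
  have hown : ∀ u, H.Adj x u → f u ≠ f x := fun u hu h =>
    hx (hf.isColorful_of_adj_of_eq hu h)
  have hthird : ∀ u, H.Adj x u → ∀ s, s = f x ∨ s = t ∨ s = f u := fun u hu =>
    eq_or_eq_or_eq_of_ne ht.symm (hown u hu).symm (hmiss u hu).symm
  have hsecond : ∀ u w, H.Adj x u → H.Adj u w → f w ≠ t := fun u w =>
    apply_ne_of_not_hasFork hfork hy hz hyz ht fun v hv => ⟨hown v hv, hmiss v hv⟩
  have hnbr : ∀ u, H.Adj x u → ¬ IsColorful H f u := fun u hu h => by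
    obtain ⟨w, hw, hwt⟩ := h t (hmiss u hu).symm
    exact hsecond u w hu hw hwt
  by_cases hleaf : ∃ w, H.Adj y w ∧ w ≠ x
  · -- recolouring `x` by `t` would make `y` colourful
    obtain ⟨w, hw, hwx⟩ := hleaf
    have hfw : f w = f x := by
      have hne : f w ≠ f y := fun h => hnbr y hy (hf.isColorful_of_adj_of_eq hw h)
      grind [hthird y hy (f w), hsecond y w hy hw]
    refine hf.not_isColorful_update ht hmiss hnbr hy fun s hs => ?_
    rw [Function.update_of_ne hy.ne'] at hs
    rcases hthird y hy s with rfl | rfl | rfl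
    · exact ⟨w, hw, by rw [Function.update_of_ne hwx, hfw]⟩
    · exact ⟨x, hy.symm, Function.update_self ..⟩
    · exact absurd rfl hs
  · -- recolouring `y` by `t` would make `x` colourful
    push Not at hleaf
    refine hf.not_isColorful_update (hmiss y hy).symm (fun w hw => hleaf w hw ▸ ht.symm)
      (fun w hw => hleaf w hw ▸ hx) hy.symm fun s hs => ?_
    rw [Function.update_of_ne hy.ne] at hs
    rcases hthird z hz s with rfl | rfl | rfl
    · exact absurd rfl hs
    · exact ⟨y, hy, Function.update_self ..⟩
    · exact ⟨z, hz, Function.update_of_ne hyz.symm ..⟩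

end ThreeColors

section Legs

variable {V C : Type*} {G : SimpleGraph V} {D : Set V} {x y : V}

/-- The graph `G - D`, with the vertices of `D` kept as isolated vertices. -/
def outside (G : SimpleGraph V) (D : Set V) : SimpleGraph V := (G.induce Dᶜ).spanningCoe

theorem outside_adj : (outside G D).Adj x y ↔ G.Adj x y ∧ x ∉ D ∧ y ∉ D := by
  simp only [outside, map_adj, comap_adj, Function.Embedding.subtype_apply, Subtype.exists,
    Set.mem_compl_iff]
  grind

/-- A leg of `x` is an edge from `x` to `D`; its colour is given by the function `γ` of its end
in `D`. -/
def HasLeg (G : SimpleGraph V) (D : Set V) (γ : V → C) (x : V) (t : C) : Prop :=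
  ∃ y ∈ D, G.Adj x y ∧ γ y = t

/-- Every colour occurs on a leg of `x` or on a neighbour of `x` outside `D`. -/
def IsFlexible (G : SimpleGraph V) (D : Set V) (f γ : V → C) (x : V) : Prop :=
  ∀ t, HasLeg G D γ x t ∨ ∃ y, (outside G D).Adj x y ∧ f y = t

theorem IsColorful.isFlexible {f γ : V → C} (hx : IsColorful (outside G D) f x)
    (hleg : HasLeg G D γ x (f x)) : IsFlexible G D f γ x := fun t => by
  by_cases ht : t = f x
  exacts [.inl (ht ▸ hleg), .inr (hx t ht)]

variable {f : V → ZMod 3}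

theorem eq_or_eq_or_eq_neg_add {a b : ZMod 3} (hab : b ≠ a) (t : ZMod 3) :
    t = a ∨ t = b ∨ t = -(a + b) := by decide +revert

theorem exists_isFlexible_of_two_legs (hf : IsOptimal (outside G D) f) (hx : x ∉ D)
    {y₀ y₁ y₂ : V} (hy₀ : y₀ ∈ D) (hy₁ : y₁ ∈ D) (h₀ : G.Adj x y₀) (h₁ : G.Adj x y₁)
    (h₂ : G.Adj x y₂) (h₁₀ : y₁ ≠ y₀) (h₂₀ : y₂ ≠ y₀) (h₂₁ : y₂ ≠ y₁) :
    ∃ γ : V → ZMod 3, HasLeg G D γ x (f x) ∧ IsFlexible G D f γ x := by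
  classical
  by_cases hsame : y₂ ∉ D ∧ f y₂ = f x
  · have hcol : IsColorful (outside G D) f x :=
      hf.isColorful_of_adj_of_eq (outside_adj.2 ⟨h₂, hx, hsame.1⟩) hsame.2
    have hleg : HasLeg G D (fun _ => f x) x (f x) := ⟨y₀, hy₀, h₀, rfl⟩
    exact ⟨fun _ => f x, hleg, hcol.isFlexible hleg⟩
  obtain ⟨b, hb, hby⟩ : ∃ b ≠ f x, y₂ ∉ D → f y₂ = b := by
    by_cases hy₂ : y₂ ∈ D
    · exact (exists_ne (f x)).imp fun b hb => ⟨hb, fun h => absurd hy₂ h⟩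
    · exact ⟨f y₂, fun h => hsame ⟨hy₂, h⟩, fun _ => rfl⟩
  let γ : V → ZMod 3 := fun v => if v = y₀ then f x else if v = y₁ then -(f x + b) else b
  have hleg : HasLeg G D γ x (f x) := ⟨y₀, hy₀, h₀, if_pos rfl⟩
  refine ⟨γ, hleg, fun t => ?_⟩
  obtain rfl | rfl | rfl := eq_or_eq_or_eq_neg_add hb t
  · exact .inl hleg
  · by_cases hy₂ : y₂ ∈ D
    · exact .inl ⟨y₂, hy₂, h₂, by simp only [γ, if_neg h₂₀, if_neg h₂₁]⟩
    · exact .inr ⟨y₂, outside_adj.2 ⟨h₂, hx, hy₂⟩, hby hy₂⟩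
  · exact .inl ⟨y₁, hy₁, h₁, by simp only [γ, if_neg h₁₀, if_true]⟩

theorem exists_leg_coloring (hD : IsConnectedWayDominating 3 G D)
    (hf : IsOptimal (outside G D) f) (hx : x ∉ D) :
    ∃ γ : V → ZMod 3, HasLeg G D γ x (f x) ∧
      (IsFlexible G D f γ x ∨ HasFork (outside G D) f x) := by
  obtain ⟨y₀, hy₀, h₀⟩ := hD.dominating x hx
  obtain ⟨y₁, y₂, ⟨h₁, h₁₀⟩, ⟨h₂, h₂₀⟩, h₁₂⟩ :
      ∃ y₁ y₂, y₁ ∈ G.neighborSet x \ {y₀} ∧ y₂ ∈ G.neighborSet x \ {y₀} ∧ y₁ ≠ y₂ := by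
    refine Set.one_lt_encard_iff.1 (lt_of_lt_of_le ?_
      (Set.encard_tsub_one_le_encard_sdiff_singleton _ _))
    exact lt_of_lt_of_le (by exact_mod_cast (by norm_num : 1 < 3 - 1))
      (tsub_le_tsub_right (hD.degree_ge x hx) 1)
  by_cases hy₁ : y₁ ∈ D
  · obtain ⟨γ, hleg, hγ⟩ :=
      exists_isFlexible_of_two_legs hf hx hy₀ hy₁ h₀ h₁ h₂ h₁₀ h₂₀ h₁₂.symm
    exact ⟨γ, hleg, .inl hγ⟩
  by_cases hy₂ : y₂ ∈ D
  · obtain ⟨γ, hleg, hγ⟩ := exists_isFlexible_of_two_legs hf hx hy₀ hy₂ h₀ h₂ h₁ h₂₀ h₁₀ h₁₂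
    exact ⟨γ, hleg, .inl hγ⟩
  have hleg : HasLeg G D (fun _ => f x) x (f x) := ⟨y₀, hy₀, h₀, rfl⟩
  refine ⟨fun _ => f x, hleg, ?_⟩
  exact (hf.isColorful_or_hasFork (outside_adj.2 ⟨h₁, hx, hy₁⟩) (outside_adj.2 ⟨h₂, hx, hy₂⟩)
    h₁₂).imp_left (·.isFlexible hleg)

/-- For every vertex `x` outside `D`, the function `g x` colours the legs of `x` in such a way that
the colour `f x` occurs, and `x` is flexible unless it has a fork. -/
structure IsLegColoring (G : SimpleGraph V) (D : Set V) (f : V → ZMod 3) (g : V → V → ZMod 3) :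
    Prop where
  hasLeg : ∀ x ∉ D, HasLeg G D (g x) x (f x)
  isFlexible_or_hasFork : ∀ x ∉ D, IsFlexible G D f (g x) x ∨ HasFork (outside G D) f x

theorem exists_isLegColoring (hD : IsConnectedWayDominating 3 G D)
    (hf : IsOptimal (outside G D) f) : ∃ g, IsLegColoring G D f g := by
  choose! g hleg hg using fun x (hx : x ∉ D) => exists_leg_coloring hD hf hx
  exact ⟨g, hleg, hg⟩

end Legs

section Fans

variable {V K : Type*} {G : SimpleGraph V} {D : Set V} {x : V} {P Q : Set V}

/-- A branch is a path from `x` to a vertex of `D`, its only vertex in `D`, such that consecutive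
edges have different colours: `e` is the colour of the first edge, `t` the colour of the last one,
and `P` is the set of the vertices outside `D`. -/
inductive IsBranch (c : G.EdgeLabeling K) (D : Set V) : V → K → K → Set V → Prop
  | leg {x y : V} (hx : x ∉ D) (hy : y ∈ D) (h : G.Adj x y) :
      IsBranch c D x (c.get x y h) (c.get x y h) {x}
  | step {x y : V} {e t : K} {P : Set V} (hx : x ∉ D) (h : G.Adj x y) (hy : IsBranch c D y e t P)
      (hxP : x ∉ P) (hc : c.get x y h ≠ e) : IsBranch c D x (c.get x y h) t (insert x P)

section

variable {c : G.EdgeLabeling K} {e t : K}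

theorem IsBranch.mem (h : IsBranch c D x e t P) : x ∈ P := by
  cases h with
  | leg => exact rfl
  | step => exact Set.mem_insert ..

theorem IsBranch.disjoint (h : IsBranch c D x e t P) : Disjoint D P := by
  induction h with
  | leg hx => exact Set.disjoint_singleton_right.2 hx
  | step hx _ _ _ _ ih => exact Set.disjoint_insert_right.2 ⟨hx, ih⟩

theorem IsBranch.exists_attach [Finite V] (h : IsBranch c D x e t P) :
    ∃ y ∈ D, ∀ T : G.Subgraph, IsProperTree c T → y ∈ T.verts → Disjoint T.verts P →
      (∀ z ∈ D, t ∉ colorsAt c T z) →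
      ∃ T' : G.Subgraph, IsProperTree c T' ∧ T'.verts = T.verts ∪ P ∧ colorsAt c T' x = {e} ∧
        ∀ z ∈ D, colorsAt c T' z ⊆ insert t (colorsAt c T z) := by
  induction h with
  | @leg x y hx hy h =>
    refine ⟨y, hy, fun T hT hyT hP hD => ?_⟩
    obtain ⟨T', hT', hverts, hcol, hcoly, hcolz⟩ :=
      hT.exists_attach_leaf hyT (Set.disjoint_singleton_right.1 hP) h (hD y hy)
    refine ⟨T', hT', by rw [hverts, Set.union_singleton], hcol, fun z hz => ?_⟩
    by_cases hzy : z = y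
    · rw [hzy, hcoly]
    · rw [hcolz z (fun h => hx (h ▸ hz)) hzy]
      exact Set.subset_insert ..
  | @step x y e t P hx h hy hxP hc ih =>
    obtain ⟨d, hd, ih⟩ := ih
    refine ⟨d, hd, fun T hT hdT hP hD => ?_⟩
    rw [Set.disjoint_insert_right] at hP
    obtain ⟨T₁, hT₁, hverts₁, hcol₁, hD₁⟩ := ih T hT hdT hP.2 hD
    have hyT₁ : y ∈ T₁.verts := hverts₁ ▸ Or.inr hy.mem
    have hxT₁ : x ∉ T₁.verts := hverts₁ ▸ not_or.2 ⟨hP.1, hxP⟩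
    obtain ⟨T₂, hT₂, hverts₂, hcol₂, -, hcolz⟩ :=
      hT₁.exists_attach_leaf hyT₁ hxT₁ h (hcol₁ ▸ hc)
    refine ⟨T₂, hT₂, by rw [hverts₂, hverts₁, Set.union_insert], hcol₂, fun z hz => ?_⟩
    have hzy : z ≠ y := fun hzy => Set.disjoint_left.1 hy.disjoint hz (hzy ▸ hy.mem)
    rw [hcolz z (fun h => hx (h ▸ hz)) hzy]
    exact hD₁ z hz

end

variable {C : Type*} {c : G.EdgeLabeling (K ⊕ C)} {a t : C} {y : V} {I J : Finset C} {S : Set V}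

/-- The vertex `x` enters `D` with the colour `t` through `P`: there is a branch at `x` with vertex
set `P` outside `D` whose last edge has the colour `t` in the second palette. -/
def Enters (c : G.EdgeLabeling (K ⊕ C)) (D : Set V) (x : V) (t : C) (P : Set V) : Prop :=
  ∃ e, IsBranch c D x e (Sum.inr t) P

theorem Enters.mem (h : Enters c D x t P) : x ∈ P :=
  h.elim fun _ hP => hP.mem

/-- A fan over `D` on the vertex set `P` with the colours `I`: prescribing at most `|I|` vertices of
a tree `T` inside `D` is enough to extend `T` by the vertices of `P`, using only the colours `I` of
the second palette at the vertices of `D`. -/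
def IsFan (c : G.EdgeLabeling (K ⊕ C)) (D : Set V) (I : Finset C) (P : Set V) : Prop :=
  ∃ Y : Finset V, (Y : Set V) ⊆ D ∧ Y.card ≤ I.card ∧
    ∀ T : G.Subgraph, IsProperTree c T → (Y : Set V) ⊆ T.verts → T.verts ⊆ D →
      (∀ z ∈ D, ∀ t, Sum.inr t ∉ colorsAt c T z) →
      ∃ T' : G.Subgraph, IsProperTree c T' ∧ T'.verts = T.verts ∪ P ∧
        ∀ z ∈ D, ∀ t, Sum.inr t ∈ colorsAt c T' z → t ∈ I

theorem isFan_empty : IsFan c D ∅ ∅ :=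
  ⟨∅, by simp, le_rfl, fun T hT _ _ hD => ⟨T, hT, by simp, fun z hz t ht => absurd ht (hD z hz t)⟩⟩

theorem IsFan.mono (hP : IsFan c D I P) (hIJ : I ⊆ J) : IsFan c D J P := by
  obtain ⟨Y, hYD, hcard, hY⟩ := hP
  refine ⟨Y, hYD, hcard.trans (Finset.card_le_card hIJ), fun T hT hYT hTD hD => ?_⟩
  obtain ⟨T', hT', hverts, hcol⟩ := hY T hT hYT hTD hD
  exact ⟨T', hT', hverts, fun z hz t ht => hIJ (hcol z hz t ht)⟩

theorem IsFan.insert_branch [Finite V] [DecidableEq C] (hP : IsFan c D I P)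
    (hQ : Enters c D x t Q) (ht : t ∉ I) (hPQ : Disjoint P Q) :
    IsFan c D (insert t I) (P ∪ Q) := by
  classical
  obtain ⟨Y, hYD, hcard, hY⟩ := hP
  obtain ⟨e, hQ⟩ := hQ
  obtain ⟨y, hyD, hy⟩ := hQ.exists_attach
  refine ⟨insert y Y, by simp [Set.insert_subset_iff, hyD, hYD], ?_, fun T hT hYT hTD hD => ?_⟩
  · rw [Finset.card_insert_of_notMem ht]
    exact (Finset.card_insert_le y Y).trans (Nat.succ_le_succ hcard)
  rw [Finset.coe_insert, Set.insert_subset_iff] at hYT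
  obtain ⟨T₁, hT₁, hverts₁, hcol₁⟩ := hY T hT hYT.2 hTD hD
  obtain ⟨T₂, hT₂, hverts₂, -, hcol₂⟩ := hy T₁ hT₁ (hverts₁ ▸ Or.inl hYT.1)
    (hverts₁ ▸ Set.disjoint_union_left.2 ⟨hQ.disjoint.mono_left hTD, hPQ⟩)
    (fun z hz h => ht (hcol₁ z hz t h))
  refine ⟨T₂, hT₂, by rw [hverts₂, hverts₁, Set.union_assoc], fun z hz s hs => ?_⟩
  obtain h | h := hcol₂ z hz hs
  · exact Finset.mem_insert.2 (.inl (Sum.inr_injective h))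
  · exact Finset.mem_insert_of_mem (hcol₁ z hz s h)

/-- The vertices of `S` lie on a fan with the colours `I`. -/
def IsCovered (c : G.EdgeLabeling (K ⊕ C)) (D : Set V) (I : Finset C) (S : Set V) : Prop :=
  ∃ P, S ⊆ P ∧ IsFan c D I P

theorem Enters.isCovered [Finite V] (h : Enters c D x t P) : IsCovered c D {t} {x} := by
  classical
  exact ⟨∅ ∪ P, Set.singleton_subset_iff.2 (.inr h.mem),
    isFan_empty.insert_branch h (by simp) (Set.empty_disjoint P)⟩

/-- The vertices `x` and `y` enter `D` through disjoint sets of vertices, with two different colours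
other than `a`. -/
def EnterJointly (c : G.EdgeLabeling (K ⊕ C)) (D : Set V) (a : C) (x y : V) : Prop :=
  ∃ s t P Q, s ≠ t ∧ s ≠ a ∧ t ≠ a ∧ Disjoint P Q ∧ Enters c D x s P ∧ Enters c D y t Q

theorem EnterJointly.symm (h : EnterJointly c D a x y) : EnterJointly c D a y x := by
  obtain ⟨s, t, P, Q, hst, hs, ht, hPQ, hP, hQ⟩ := h
  exact ⟨t, s, Q, P, hst.symm, ht, hs, hPQ.symm, hQ, hP⟩

theorem EnterJointly.exists_isCovered [Finite V] (h : EnterJointly c D a x y) :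
    ∃ I, a ∉ I ∧ IsCovered c D I {y, x} := by
  classical
  obtain ⟨s, t, P, Q, hst, hs, ht, hPQ, hP, hQ⟩ := h
  have hfan : IsFan c D {t, s} (∅ ∪ P ∪ Q) :=
    (isFan_empty.insert_branch hP (by simp) (Set.empty_disjoint P)).insert_branch hQ
      (by simpa using hst.symm) (by simpa using hPQ)
  exact ⟨{t, s}, by simp [hs.symm, ht.symm], _,
    Set.insert_subset (.inr hQ.mem) (Set.singleton_subset_iff.2 (.inl (.inr hP.mem))), hfan⟩

theorem IsCovered.insert_leg [Finite V] [DecidableEq C] (hS : IsCovered c D I S)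
    (hx : Enters c D x t {x}) (ht : t ∉ I) : IsCovered c D (insert t I) (insert x S) := by
  obtain ⟨P, hSP, hP⟩ := hS
  by_cases hxP : x ∈ P
  · exact ⟨P, Set.insert_subset hxP hSP, hP.mono (Finset.subset_insert t I)⟩
  · exact ⟨P ∪ {x}, Set.insert_subset (.inr rfl) (hSP.trans Set.subset_union_left),
      hP.insert_branch hx ht (Set.disjoint_singleton_right.2 hxP)⟩

end Fans

section Entering

variable {V K : Type*} {G : SimpleGraph V} {D : Set V} {x y u w : V}

/-- The edge colouring of `G` which extends the colouring `c₀` of `G[D]`: an edge from `x ∉ D` to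
`y ∈ D` gets the colour `g x y`, and an edge `x y` outside `D` gets the colour `-(f x + f y)`, which
is the third one if `f x ≠ f y`. -/
noncomputable def extendLabeling (c₀ : (G.induce D).EdgeLabeling K) (f : V → ZMod 3)
    (g : V → V → ZMod 3) : G.EdgeLabeling (K ⊕ ZMod 3) :=
  open Classical in
  EdgeLabeling.mk (fun x y h =>
    if hx : x ∈ D then
      if hy : y ∈ D then Sum.inl (c₀.get ⟨x, hx⟩ ⟨y, hy⟩ (induce_adj.2 h))
      else Sum.inr (g y x)
    else if y ∈ D then Sum.inr (g x y) else Sum.inr (-(f x + f y)))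
    (by
      intro x y h
      by_cases hx : x ∈ D <;> by_cases hy : y ∈ D
      · simp only [hx, hy, dif_pos]
        exact congrArg Sum.inl
          (EdgeLabeling.get_comm (C := c₀) ⟨x, hx⟩ ⟨y, hy⟩ (induce_adj.2 h.symm))
      all_goals simp [hx, hy, add_comm])

variable {c₀ : (G.induce D).EdgeLabeling K} {f : V → ZMod 3} {g : V → V → ZMod 3} {t : ZMod 3}

theorem extendLabeling_get_inside (x y : D) (h : (G.induce D).Adj x y) :
    (extendLabeling c₀ f g).get x y (induce_adj.1 h) = Sum.inl (c₀.get x y h) := by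
  rw [extendLabeling, EdgeLabeling.get_mk, dif_pos x.2, dif_pos y.2]

theorem extendLabeling_get_leg (hx : x ∉ D) (hy : y ∈ D) (h : G.Adj x y) :
    (extendLabeling c₀ f g).get x y h = Sum.inr (g x y) := by
  rw [extendLabeling, EdgeLabeling.get_mk, dif_neg hx, if_pos hy]

theorem extendLabeling_get_outside (hx : x ∉ D) (hy : y ∉ D) (h : G.Adj x y) :
    (extendLabeling c₀ f g).get x y h = Sum.inr (-(f x + f y)) := by
  rw [extendLabeling, EdgeLabeling.get_mk, dif_neg hx, if_neg hy]

theorem HasLeg.isBranch (hleg : HasLeg G D (g x) x t) (hx : x ∉ D) :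
    IsBranch (extendLabeling c₀ f g) D x (Sum.inr t) (Sum.inr t) {x} := by
  obtain ⟨y, hy, h, rfl⟩ := hleg
  rw [← extendLabeling_get_leg hx hy h]
  exact .leg hx hy h

theorem IsBranch.extend_outside {a s : ZMod 3} {P : Set V}
    (hy : IsBranch (extendLabeling c₀ f g) D y (Sum.inr a) (Sum.inr t) P)
    (h : (outside G D).Adj x y) (hxP : x ∉ P) (hs : -(f x + f y) = s) (hne : s ≠ a) :
    IsBranch (extendLabeling c₀ f g) D x (Sum.inr s) (Sum.inr t) (insert x P) := by
  obtain ⟨hxy, hx, hyD⟩ := outside_adj.1 h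
  have hget := extendLabeling_get_outside (c₀ := c₀) (f := f) (g := g) hx hyD hxy
  rw [hs] at hget
  rw [← hget]
  exact .step hx hxy hy hxP (hget ▸ Sum.inr_injective.ne hne)

theorem neg_add_ne_of_ne {a b : ZMod 3} (h : b ≠ a) : -(a + b) ≠ b := by decide +revert

theorem neg_add_eq_of_ne {a b s : ZMod 3} (hab : b ≠ a) (ha : s ≠ a) (hb : s ≠ b) :
    -(a + b) = s := by decide +revert

namespace IsLegColoring

theorem isBranch_self (hg : IsLegColoring G D f g) (hx : x ∉ D) :
    IsBranch (extendLabeling c₀ f g) D x (Sum.inr (f x)) (Sum.inr (f x)) {x} :=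
  (hg.hasLeg x hx).isBranch hx

theorem enters_self (hg : IsLegColoring G D f g) (hx : x ∉ D) :
    Enters (extendLabeling c₀ f g) D x (f x) {x} :=
  ⟨_, hg.isBranch_self hx⟩

theorem enters_of_adj (hg : IsLegColoring G D f g) (h : (outside G D).Adj x y)
    (hne : f y ≠ f x) : Enters (extendLabeling c₀ f g) D x (f y) {x, y} :=
  ⟨_, (hg.isBranch_self (outside_adj.1 h).2.2).extend_outside h h.ne rfl (neg_add_ne_of_ne hne)⟩

theorem enters_of_adj_of_adj (hg : IsLegColoring G D f g) (hu : (outside G D).Adj x u)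
    (hw : (outside G D).Adj u w) (hux : f u ≠ f x) (hwx : f w ≠ f x) (hwu : f w ≠ f u) :
    Enters (extendLabeling c₀ f g) D x (f w) {x, u, w} := by
  have hfxu : -(f u + f w) = f x := neg_add_eq_of_ne hwu hux.symm hwx.symm
  have hfw : -(f x + f u) = f w := neg_add_eq_of_ne hux hwx hwu
  have hxw : x ≠ w := fun h => hwx (h ▸ rfl)
  exact ⟨_, ((hg.isBranch_self (outside_adj.1 hw).2.2).extend_outside hw hw.ne hfxu
    hwx.symm).extend_outside hu (by simp [hu.ne, hxw]) hfw hwx⟩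

theorem exists_enters_of_isFlexible (hg : IsLegColoring G D f g) (hx : x ∉ D)
    (h : IsFlexible G D f (g x) x) (t : ZMod 3) :
    ∃ P, Enters (extendLabeling c₀ f g) D x t P ∧ ∀ z ∈ P, z = x ∨ f z = t := by
  obtain hleg | ⟨y, hxy, rfl⟩ := h t
  · exact ⟨{x}, ⟨_, hleg.isBranch hx⟩, fun z hz => .inl hz⟩
  by_cases hne : f y = f x
  · exact ⟨{x}, hne ▸ hg.enters_self hx, fun z hz => .inl hz⟩
  · exact ⟨{x, y}, hg.enters_of_adj hxy hne, fun z hz => hz.imp_right (congrArg f)⟩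

theorem exists_enters (hg : IsLegColoring G D f g) (hx : x ∉ D) (t : ZMod 3) :
    ∃ P, Enters (extendLabeling c₀ f g) D x t P := by
  obtain h | ⟨u, -, w, hu, -, -, -, hux, hw, hwx, hwu⟩ := hg.isFlexible_or_hasFork x hx
  · exact (hg.exists_enters_of_isFlexible hx h t).imp fun _ => And.left
  obtain rfl | rfl | rfl := eq_or_eq_or_eq_of_ne hux.symm hwx.symm hwu.symm t
  · exact ⟨_, hg.enters_self hx⟩
  · exact ⟨_, hg.enters_of_adj hu hux⟩
  · exact ⟨_, hg.enters_of_adj_of_adj hu hw hux hwx hwu⟩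

theorem exists_enters_ne (hg : IsLegColoring G D f g) (hx : x ∉ D) :
    ∃ t P, t ≠ f x ∧ Enters (extendLabeling c₀ f g) D x t P ∧ ∀ z ∈ P, z = x ∨ f z = t := by
  obtain h | ⟨u, -, -, hu, -, -, -, hux, -⟩ := hg.isFlexible_or_hasFork x hx
  · obtain ⟨t, ht⟩ := exists_ne (f x)
    obtain ⟨P, hP⟩ := hg.exists_enters_of_isFlexible hx h t
    exact ⟨t, P, ht, hP⟩
  · exact ⟨f u, {x, u}, hux, hg.enters_of_adj hu hux, fun z hz => hz.imp_right (congrArg f)⟩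

theorem enterJointly_of_isFlexible (hg : IsLegColoring G D f g) (hx : x ∉ D) (hy : y ∉ D)
    (hxy : x ≠ y) (hf : f x = f y) (h : IsFlexible G D f (g x) x) :
    EnterJointly (extendLabeling c₀ f g) D (f x) x y := by
  obtain ⟨t, Q, ht, hQ, hQt⟩ := hg.exists_enters_ne (c₀ := c₀) hy
  obtain ⟨s, hs, hst⟩ := exists_ne_and_ne (f x) t
  obtain ⟨P, hP, hPs⟩ := hg.exists_enters_of_isFlexible (c₀ := c₀) hx h s
  refine ⟨s, t, P, Q, hst, hs, hf ▸ ht, Set.disjoint_left.2 fun z hzP hzQ => ?_, hP, hQ⟩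
  grind

theorem enterJointly_of_hasFork (hg : IsLegColoring G D f g) (hxy : x ≠ y)
    (hf : f x = f y) (hx : HasFork (outside G D) f x) (hy : HasFork (outside G D) f y) :
    EnterJointly (extendLabeling c₀ f g) D (f x) x y := by
  obtain ⟨u, -, w, hu, -, -, -, hux, hw, hwx, hwu⟩ := hx
  obtain ⟨v, v', -, hv, hv', hvv', hfv', hvy, -, -, -⟩ := hy
  by_cases huv : f u = f v
  · obtain ⟨q, hq, hqu, hfq⟩ : ∃ q, (outside G D).Adj y q ∧ q ≠ u ∧ f q = f u := by
      by_cases h : v = u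
      · exact ⟨v', hv', fun h' => hvv' (h.trans h'.symm), hfv'.trans huv.symm⟩
      · exact ⟨v, hv, h, huv.symm⟩
    have hdisj : Disjoint ({x, u, w} : Set V) {y, q} := by
      rw [Set.disjoint_left]
      grind
    exact ⟨f w, f q, _, _, hfq ▸ hwu, hwx, hfq ▸ hux, hdisj,
      hg.enters_of_adj_of_adj hu hw hux hwx hwu, hg.enters_of_adj hq (by grind)⟩
  · have hdisj : Disjoint ({x, u} : Set V) {y, v} := by
      rw [Set.disjoint_left]
      grind
    exact ⟨f u, f v, _, _, huv, hux, hf ▸ hvy, hdisj, hg.enters_of_adj hu hux,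
      hg.enters_of_adj hv hvy⟩

theorem enterJointly (hg : IsLegColoring G D f g) (hx : x ∉ D) (hy : y ∉ D)
    (hxy : x ≠ y) (hf : f x = f y) :
    EnterJointly (extendLabeling c₀ f g) D (f x) x y := by
  obtain hx' | hx' := hg.isFlexible_or_hasFork x hx
  · exact hg.enterJointly_of_isFlexible hx hy hxy hf hx'
  obtain hy' | hy' := hg.isFlexible_or_hasFork y hy
  · exact hf ▸ (hg.enterJointly_of_isFlexible hy hx hxy.symm hf.symm hy').symm
  · exact hg.enterJointly_of_hasFork hxy hf hx' hy'

theorem isCovered_of_injOn [Finite V] (hg : IsLegColoring G D f g) (S : Finset V)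
    (hS : ∀ x ∈ S, x ∉ D) (hf : Set.InjOn f S) :
    IsCovered (extendLabeling c₀ f g) D (S.image f) S := by
  classical
  induction S using Finset.induction_on with
  | empty => exact ⟨∅, by simp, isFan_empty⟩
  | insert x S hxS ih =>
    rw [Finset.image_insert, Finset.coe_insert] at *
    refine (ih (fun y hy => hS y (Finset.mem_insert_of_mem hy))
      (hf.mono (Set.subset_insert _ _))).insert_leg
        (hg.enters_self (hS x (Finset.mem_insert_self x S))) fun h => ?_
    obtain ⟨y, hy, hyx⟩ := Finset.mem_image.1 h
    exact hxS (hf (.inr hy) (.inl rfl) hyx ▸ hy)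

theorem isCovered_pair [Finite V] (hg : IsLegColoring G D f g) (hx : x ∉ D) (hy : y ∉ D)
    (hf : f x = f y) (ht : t ≠ f x) : IsCovered (extendLabeling c₀ f g) D {f y, t} {y, x} := by
  obtain ⟨P, hP⟩ := hg.exists_enters (c₀ := c₀) hx t
  exact hP.isCovered.insert_leg (hg.enters_self hy) (by grind)

theorem exists_isCovered_triple [Finite V] (hg : IsLegColoring G D f g) {z : V} (hx : x ∉ D)
    (hy : y ∉ D) (hz : z ∉ D) (hxy : x ≠ y) (hf : f x = f y) :
    ∃ I, IsCovered (extendLabeling c₀ f g) D I {z, y, x} := by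
  by_cases hfz : f z = f x
  · obtain ⟨I, hI, hcov⟩ := (hg.enterJointly (c₀ := c₀) hx hy hxy hf).exists_isCovered
    exact ⟨_, hcov.insert_leg (hg.enters_self hz) (hfz ▸ hI)⟩
  · obtain ⟨t, ht, htz⟩ := exists_ne_and_ne (f x) (f z)
    exact ⟨_, (hg.isCovered_pair hx hy hf ht).insert_leg (hg.enters_self hz) (by grind)⟩

theorem exists_isCovered [Finite V] (hg : IsLegColoring G D f g) (S : Finset V)
    (hS : ∀ x ∈ S, x ∉ D) (hcard : S.card ≤ 3) :
    ∃ I, IsCovered (extendLabeling c₀ f g) D I S ∧ I.card ≤ S.card := by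
  classical
  by_cases hf : Set.InjOn f S
  · exact ⟨_, hg.isCovered_of_injOn S hS hf, Finset.card_image_le⟩
  obtain ⟨x, hx, y, hy, hfxy, hxy⟩ : ∃ x ∈ S, ∃ y ∈ S, f x = f y ∧ x ≠ y := by
    simpa [Set.InjOn] using hf
  have hsub : {x, y} ⊆ S := Finset.insert_subset hx (Finset.singleton_subset_iff.2 hy)
  have hcard₂ : ({x, y} : Finset V).card = 2 := Finset.card_pair hxy
  by_cases hS₂ : S.card ≤ 2
  · obtain rfl : {x, y} = S := Finset.eq_of_subset_of_card_le hsub (hcard₂.symm ▸ hS₂)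
    obtain ⟨t, ht⟩ := exists_ne (f x)
    refine ⟨{f y, t}, ?_, Finset.card_le_two.trans hcard₂.ge⟩
    rw [Finset.coe_pair, Set.pair_comm]
    exact hg.isCovered_pair (hS x hx) (hS y hy) hfxy ht
  · obtain ⟨z, hz, hzxy⟩ :=
      Finset.exists_mem_notMem_of_card_lt_card (hcard₂.trans_lt (not_le.1 hS₂))
    have hS₃ : S = {z, y, x} := (Finset.eq_of_subset_of_card_le (by grind) (by grind)).symm
    obtain ⟨I, hI⟩ := hg.exists_isCovered_triple (c₀ := c₀) (hS x hx) (hS y hy) (hS z hz) hxy hfxy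
    exact ⟨I, by simpa [hS₃] using hI, I.card_le_univ.trans (not_le.1 hS₂)⟩

end IsLegColoring

end Entering

section Assembly

variable {V K : Type*} {G : SimpleGraph V} {D : Set V}

theorem exists_properTree_inside [Finite V] {c₀ : (G.induce D).EdgeLabeling K} {k : ℕ}
    (hD : (G.induce D).Connected) (hk : k ≤ 3) (hc₀ : IsKProperColoring k c₀) (f : V → ZMod 3)
    (g : V → V → ZMod 3) {S : Finset V} (hSD : (S : Set V) ⊆ D) (hcard : S.card ≤ k) :
    ∃ T : G.Subgraph, IsProperTree (extendLabeling c₀ f g) T ∧ (S : Set V) ⊆ T.verts ∧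
      T.verts ⊆ D ∧ ∀ x t, Sum.inr t ∉ colorsAt (extendLabeling c₀ f g) T x := by
  classical
  obtain ⟨T, hST, hT⟩ := exists_properTree_of_card_le hD hk hc₀ (S.subtype (· ∈ D))
    ((Finset.card_subtype ..).trans_le ((Finset.card_filter_le ..).trans hcard))
  refine ⟨T.map (Embedding.induce D).toHom, hT.map (Embedding.induce D).toCopy Sum.inl_injective
    extendLabeling_get_inside, fun x hx => ⟨⟨x, hSD hx⟩, hST (by simpa using hx), rfl⟩, ?_, ?_⟩
  · rintro _ ⟨x, -, rfl⟩
    exact x.2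
  · rintro _ t ⟨_, ⟨x, y, h, rfl, rfl⟩, hxy⟩
    exact Sum.inl_ne_inr ((extendLabeling_get_inside x y h.adj_sub).symm.trans hxy)

theorem IsLegColoring.isKProperColoring [Finite V] {c₀ : (G.induce D).EdgeLabeling K}
    {f : V → ZMod 3} {g : V → V → ZMod 3} {k : ℕ} (hg : IsLegColoring G D f g)
    (hD : (G.induce D).Connected) (hk : k ≤ 3) (hc₀ : IsKProperColoring k c₀) :
    IsKProperColoring k (extendLabeling c₀ f g) := by
  classical
  intro S hS
  have hsplit : (S.filter (· ∈ D)).card + (S.filter (· ∉ D)).card = k :=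
    (Finset.card_filter_add_card_filter_not _).trans hS
  obtain ⟨I, ⟨P, hSP, Y, hYD, hYI, hY⟩, hI⟩ := hg.exists_isCovered (c₀ := c₀) (S.filter (· ∉ D))
    (fun x hx => (Finset.mem_filter.1 hx).2) (by omega)
  have hSYD : ((S.filter (· ∈ D) ∪ Y : Finset V) : Set V) ⊆ D := by
    intro x hx
    simp only [Finset.coe_union, Finset.coe_filter] at hx
    exact hx.elim And.right (@hYD x)
  have hcard : (S.filter (· ∈ D) ∪ Y).card ≤ k := by
    have := Finset.card_union_le (S.filter (· ∈ D)) Y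
    omega
  obtain ⟨T, hT, hST, hTD, hTcol⟩ := exists_properTree_inside hD hk hc₀ f g hSYD hcard
  rw [Finset.coe_union, Set.union_subset_iff] at hST
  obtain ⟨T', hT', hverts, -⟩ := hY T hT hST.2 hTD fun x _ => hTcol x
  refine ⟨T', fun x hx => hverts ▸ ?_, hT'⟩
  by_cases hxD : x ∈ D
  · exact .inl (hST.1 (Finset.mem_filter.2 ⟨hx, hxD⟩))
  · exact .inr (hSP (Finset.mem_filter.2 ⟨hx, hxD⟩))

theorem properIndex_le_of_dominating [Finite V] {k : ℕ} (hk : k ≤ 3)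
    (hD : IsConnectedWayDominating 3 G D) :
    properIndex k G ≤ properIndex k (G.induce D) + 3 := by
  obtain ⟨c₀, hc₀⟩ := Nat.sInf_mem (exists_isKProperColoring k hD.connected)
  obtain ⟨f, hf⟩ := exists_isOptimal (C := ZMod 3) (outside G D)
  obtain ⟨g, hg⟩ := exists_isLegColoring hD hf
  refine (properIndex_le_card (hg.isKProperColoring hD.connected hk hc₀)).trans_eq ?_
  rw [Fintype.card_sum, Fintype.card_fin, ZMod.card]
  rfl

end Assembly

section CliqueUnions

theorem properIndex_of_subsingleton {V : Type*} [Subsingleton V] {k : ℕ} (hk : 1 < k)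
    (G : SimpleGraph V) : properIndex k G = 0 := by
  have : IsEmpty G.edgeSet :=
    Set.isEmpty_coe_sort.2 (edgeSet_eq_empty.2 (Subsingleton.elim G ⊥))
  refine Nat.sInf_eq_zero.2 (.inl ⟨fun e => isEmptyElim e, fun S hS => absurd hk ?_⟩)
  exact not_lt.2 (hS ▸ Finset.card_le_one_of_subsingleton S)

variable {p : ℕ} {i : Fin p → ℕ}

theorem cliqueUnion_adj_none (x : Σ j : Fin p, Fin (i j - 1)) :
    (cliqueUnion i).Adj (some x) none :=
  ⟨Option.some_ne_none x, x.1, .inr ⟨x.2, rfl⟩, .inl rfl⟩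

theorem cliqueUnion_adj_some {j : Fin p} {y : Σ j : Fin p, Fin (i j - 1)} {a : Fin (i j - 1)} :
    (cliqueUnion i).Adj (some ⟨j, a⟩) (some y) ↔ ∃ b ≠ a, y = ⟨j, b⟩ := by
  simp only [cliqueUnion, cliquePart, Set.mem_ofPred_eq]
  grind

theorem cliqueUnion_connected : (cliqueUnion i).Connected := by
  refine connected_iff_exists_forall_reachable _ |>.2 ⟨none, fun x => ?_⟩
  cases x with
  | none => rfl
  | some x => exact (cliqueUnion_adj_none x).symm.reachable

theorem le_encard_neighborSet_cliqueUnion (j : Fin p) (a : Fin (i j - 1)) :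
    ((i j - 1 : ℕ) : ℕ∞) ≤ ((cliqueUnion i).neighborSet (some ⟨j, a⟩)).encard := by
  -- in the clique of `x = some ⟨j, a⟩`, the common vertex takes the place of `x`
  let e : Fin (i j - 1) → CliqueUnionVertex i := fun b => if b = a then none else some ⟨j, b⟩
  have he : Function.Injective e := fun b b' h => by grind
  have hsub : Set.range e ⊆ (cliqueUnion i).neighborSet (some ⟨j, a⟩) := by
    rintro _ ⟨b, rfl⟩
    rw [mem_neighborSet]
    by_cases hb : b = a
    · simpa only [e, if_pos hb] using cliqueUnion_adj_none _
    · simpa only [e, if_neg hb] using cliqueUnion_adj_some.2 ⟨b, hb, rfl⟩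
  calc ((i j - 1 : ℕ) : ℕ∞) = (Set.range e).encard := by
        rw [← Set.image_univ, he.encard_image, Set.encard_univ, ENat.card_eq_coe_fintype_card,
          Fintype.card_fin]
    _ ≤ _ := Set.encard_le_encard hsub

theorem isConnectedWayDominating_singleton_none {s : ℕ} (hi : ∀ j, s < i j) :
    IsConnectedWayDominating s (cliqueUnion i) {none} where
  dominating x hx := by
    obtain ⟨x, rfl⟩ := Option.ne_none_iff_exists'.1 hx
    exact ⟨none, rfl, cliqueUnion_adj_none x⟩
  degree_ge x hx := by
    obtain ⟨⟨j, a⟩, rfl⟩ := Option.ne_none_iff_exists'.1 hx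
    exact (Nat.cast_le.2 (Nat.le_sub_one_of_lt (hi j))).trans
      (le_encard_neighborSet_cliqueUnion j a)
  connected := by
    have : Nonempty ({none} : Set (CliqueUnionVertex i)) := ⟨⟨none, rfl⟩⟩
    exact ⟨.of_subsingleton⟩

theorem exists_adj_none_of_connected {T : (cliqueUnion i).Subgraph} (hT : T.coe.Connected)
    {x y : Σ j : Fin p, Fin (i j - 1)} (hx : some x ∈ T.verts) (hy : some y ∈ T.verts)
    (hxy : x.1 ≠ y.1) : ∃ a, T.Adj none (some ⟨x.1, a⟩) := by
  obtain ⟨w⟩ := hT.preconnected ⟨_, hx⟩ ⟨_, hy⟩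
  obtain ⟨d, -, ⟨a, ha⟩, hsnd⟩ := w.exists_boundary_dart
    {z | ∃ a, (z : CliqueUnionVertex i) = some ⟨x.1, a⟩} ⟨x.2, rfl⟩ (by grind)
  have hadj : T.Adj (some ⟨x.1, a⟩) d.snd := ha ▸ d.adj
  cases hz : (d.snd : CliqueUnionVertex i) with
  | none => exact ⟨a, (hz ▸ hadj).symm⟩
  | some z =>
    obtain ⟨b, -, rfl⟩ := cliqueUnion_adj_some.1 (hz ▸ hadj.adj_sub)
    exact absurd ⟨b, hz⟩ hsnd

theorem le_properIndex_cliqueUnion {k : ℕ} (hk : 2 ≤ k) (hkp : k ≤ p) (hi : ∀ j, 2 ≤ i j) :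
    k ≤ properIndex k (cliqueUnion i) := by
  classical
  suffices ∀ t, (∃ c : (cliqueUnion i).EdgeLabeling (Fin t), IsKProperColoring k c) → k ≤ t from
    this _ (Nat.sInf_mem (exists_isKProperColoring k cliqueUnion_connected))
  rintro t ⟨c, hc⟩
  have : Nontrivial (Fin k) := Fin.nontrivial_iff_two_le.2 hk
  let v : Fin k → Σ j : Fin p, Fin (i j - 1) := fun l =>
    ⟨Fin.castLE hkp l, ⟨0, Nat.sub_pos_of_lt (hi _)⟩⟩
  have hv : Function.Injective fun l => (v l).1 := Fin.castLE_injective hkp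
  have hinj : Function.Injective fun l => some (v l) :=
    (Option.some_injective _).comp (.of_comp hv)
  obtain ⟨T, hST, hT, hprop⟩ := hc (Finset.univ.image fun l => some (v l))
    (by rw [Finset.card_image_of_injective _ hinj, Finset.card_fin])
  have hmem : ∀ l, some (v l) ∈ T.verts := fun l => hST (by simp)
  have hadj : ∀ l, ∃ a, T.Adj none (some ⟨(v l).1, a⟩) := fun l => by
    obtain ⟨m, hm⟩ := exists_ne l
    exact exists_adj_none_of_connected hT.1 (hmem l) (hmem m) (hv.ne hm.symm)
  choose a ha using hadj
  have hcol : Function.Injective fun l => c.get _ _ (ha l).adj_sub := fun l m h => by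
    by_contra hlm
    refine hprop none _ _ (ha l) (ha m) (fun h' => hlm (hv ?_)) h
    exact (Sigma.mk.inj_iff.1 (Option.some.inj h')).1
  simpa only [Fintype.card_fin] using Fintype.card_le_of_injective _ hcol

end CliqueUnions

end ProperIndex

theorem theorem3p1 :
    (∀ (V : Type*) [Finite V] (G : SimpleGraph V) (D : Set V), G.Connected →
      ProperIndex.IsConnectedWayDominating 3 G D →
      ProperIndex.properIndex 3 G ≤ ProperIndex.properIndex 3 (G.induce D) + 3) ∧
    (∀ (p : ℕ) (i : Fin p → ℕ), 3 ≤ p → (∀ j, 4 ≤ i j) →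
      (ProperIndex.cliqueUnion i).Connected ∧
      ProperIndex.IsConnectedWayDominating 3 (ProperIndex.cliqueUnion i) {none} ∧
      ProperIndex.properIndex 3 ((ProperIndex.cliqueUnion i).induce {none}) = 0 ∧
      ProperIndex.properIndex 3 (ProperIndex.cliqueUnion i) = 3) := by
  refine ⟨fun V _ G D _ hD => ProperIndex.properIndex_le_of_dominating le_rfl hD,
    fun p i hp hi => ?_⟩
  have hD := ProperIndex.isConnectedWayDominating_singleton_none hi
  have hzero : ProperIndex.properIndex 3 ((ProperIndex.cliqueUnion i).induce {none}) = 0 :=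
    ProperIndex.properIndex_of_subsingleton (by norm_num) _
  have hupper : ProperIndex.properIndex 3 (ProperIndex.cliqueUnion i) ≤ 3 :=
    (ProperIndex.properIndex_le_of_dominating le_rfl hD).trans_eq (by rw [hzero])
  have hlower : 3 ≤ ProperIndex.properIndex 3 (ProperIndex.cliqueUnion i) :=
    ProperIndex.le_properIndex_cliqueUnion (by norm_num) hp fun j => le_trans (by norm_num) (hi j)
  exact ⟨ProperIndex.cliqueUnion_connected, hD, hzero, hupper.antisymm hlower⟩
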